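/- For $\epsilon,\epsilon'\in\mathbb{R}$, $v\in\mathbb{C}$ and $\tau\in\mathbb{C}$ with $\operatorname{Im}\tau>0$ let $$\theta\!\left[{\epsilon\atop\epsilon'}\right](v,\tau)=\sum_{n\in\mathbb{Z}}\exp\Bigl(2\pi i\Bigl[\tfrac12\bigl(n+\tfrac{\epsilon}{2}\bigr)^2\tau+\bigl(n+\tfrac{\epsilon}{2}\bigr)\bigl(v+\tfrac{\epsilon'}{2}\bigr)\Bigr]\Bigr).$$ For $M=\begin{pmatrix}a&b\\c&d\end{pmatrix}\in SL(2,\mathbb{Z})$ let $\nu_\eta(M)$ be Knopp's explicit multiplier of the Dedekind eta function, $$\nu_\eta(M)=\begin{cases}\left(\dfrac{d}{c}\right)^{*}\exp\left\{\dfrac{\pi i}{12}\bigl[(a+d)c-bd(c^2-1)-3c\bigr]\right\}&\text{if } c \text{ is odd},\\[2mm]\left(\dfrac{c}{d}\right)_{*}\exp\left\{\dfrac{\pi i}{12}\bigl[(a+d)c-bd(c^2-1)+3d-3-3cd\bigr]\right\}&\text{if } c\text{ is even},\end{cases}$$ where, with Jacobi symbols on the right-hand sides, $\left(\frac{d}{c}\right)^{*}=\left(\frac{d}{|c|}\right)$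 for $c$ odd, and for $d$ odd $\left(\frac{c}{d}\right)_{*}=\left(\frac{c}{|d|}\right)(-1)^{\frac{\operatorname{sign}c-1}{2}\cdot\frac{\operatorname{sign}d-1}{2}}$ if $c\neq0$, while $\left(\frac{0}{1}\right)_{*}=1$ and $\left(\frac{0}{-1}\right)_{*}=-1$. Square roots are taken as $z^{1/2}=|z|^{1/2}e^{i\arg(z)/2}$ with $-\pi\le\arg z<\pi$. Then for every $M=\begin{pmatrix}a&b\\c&d\end{pmatrix}\in SL(2,\mathbb{Z})$, every $v\in\mathbb{C}$ and every $\tau$ with $\operatorname{Im}\tau>0$, $$\theta\!\left[{1\atop1}\right]\!\left(\frac{v}{c\tau+d},\frac{a\tau+b}{c\tau+d}\right)=\nu_\eta(M)^3\,(c\tau+d)^{1/2}\exp\left(\frac{\pi i\,c\,v^2}{c\tau+d}\right)\theta\!\left[{1\atop1}\right](v,\tau).$$ -/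

import Mathlib

/-- The `n`-th term of the theta series with real characteristics `ε, ε'`. -/
noncomputable def thetaCharTerm (ε ε' : ℝ) (v τ : ℂ) (n : ℤ) : ℂ :=
  Complex.exp (2 * Real.pi * Complex.I *
    (1 / 2 * ((n : ℂ) + ε / 2) ^ 2 * τ + ((n : ℂ) + ε / 2) * (v + ε' / 2)))

/-- The theta function with real characteristics `ε, ε'`,
`θ[ε, ε'](v, τ) = ∑_{n ∈ ℤ} exp (2πi [ (n + ε/2)² τ / 2 + (n + ε/2) (v + ε'/2) ])`,
for `v : ℂ` and `τ` in the upper half plane (for such `τ` the series converges absolutely, see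
`summable_thetaCharTerm` below). -/
noncomputable def thetaChar (ε ε' : ℝ) (v τ : ℂ) : ℂ :=
  ∑' n : ℤ, thetaCharTerm ε ε' v τ n

/-- The series defining `thetaChar` converges absolutely for every `τ` with `0 < Im τ`. -/
theorem summable_thetaCharTerm (ε ε' : ℝ) (v : ℂ) {τ : ℂ} (hτ : 0 < τ.im) :
    Summable (thetaCharTerm ε ε' v τ) := by
  have h := ((summable_jacobiTheta₂_term_iff (v + ε' / 2 + ε / 2 * τ) τ).2 hτ).mul_left
    (Complex.exp (2 * Real.pi * Complex.I *
      (ε ^ 2 / 8 * τ + ε / 2 * (v + ε' / 2))))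
  refine h.congr fun n => ?_
  rw [thetaCharTerm, jacobiTheta₂_term, ← Complex.exp_add]
  congr 1
  ring

/-- The upper symbol `(d / c)^* = (d / |c|)` (Jacobi symbol), for coprime `d, c` with `c` odd. -/
def upperSymbol (d c : ℤ) : ℤ := jacobiSym d c.natAbs

/-- The lower symbol, for coprime `c, d` with `d` odd: for `c ≠ 0`,
`(c / d)_* = (c / |d|) (-1) ^ ((sign c - 1) / 2 * ((sign d - 1) / 2))`,
and, for `c = 0` (where `d = 1` or `d = -1`), `(0 / 1)_* = 1` and `(0 / -1)_* = -1`. -/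
def lowerSymbol (c d : ℤ) : ℤ :=
  if c = 0 then d.sign
  else jacobiSym c d.natAbs * (-1) ^ ((c.sign - 1) / 2 * ((d.sign - 1) / 2)).natAbs

/-- Knopp's explicit formula for the multiplier `ν_η` of the Dedekind eta function. -/
noncomputable def nuEta (M : Matrix.SpecialLinearGroup (Fin 2) ℤ) : ℂ :=
  let a : ℤ := M 0 0
  let b : ℤ := M 0 1
  let c : ℤ := M 1 0
  let d : ℤ := M 1 1
  if Odd c then
    (upperSymbol d c : ℂ) * Complex.exp (Real.pi * Complex.I / 12 *
      (((a + d) * c - b * d * (c ^ 2 - 1) - 3 * c : ℤ) : ℂ))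
  else
    (lowerSymbol c d : ℂ) * Complex.exp (Real.pi * Complex.I / 12 *
      (((a + d) * c - b * d * (c ^ 2 - 1) + 3 * d - 3 - 3 * c * d : ℤ) : ℂ))

/-- The argument of `z ≠ 0` normalised by `-π ≤ arg z < π`, the convention that goes with the value
`(0 / -1)_* = -1` of the lower symbol. It differs from `Complex.arg` only on the negative reals,
where it is `-π`. -/
noncomputable def knoppArg (z : ℂ) : ℝ :=
  if Complex.arg z = Real.pi then -Real.pi else Complex.arg z

/-- The square root `z ^ (1/2) = |z| ^ (1/2) exp (i arg z / 2)` with `-π ≤ arg z < π`. -/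
noncomputable def knoppSqrt (z : ℂ) : ℂ :=
  (Real.sqrt ‖z‖ : ℂ) * Complex.exp (Complex.I * (knoppArg z : ℂ) / 2)

/-!
The transformation formula is propagated along right multiplication of `M` by the generators `S`
and `T` of `SL(2, ℤ)`.

Right multiplication by `S` substitutes `(v / τ, -1 / τ)` for `(v, τ)` in the formula for `M`; the
factor this produces comes from the functional equation of `jacobiTheta₂` (`thetaChar_one_one_S`).
The formula for `M * S` then amounts to two facts. On the analytic side, with `(c, d)` the lower
row of `M`, one has `√((dτ - c) / τ) √τ = ± √(dτ - c)`, with the minus sign exactly when `c > 0` and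
`d ≤ 0` (`knoppSqrt_automorphy_S`); the convention `-π ≤ arg z < π` matters in the cases `c = 0` and
`d = 0`. On the arithmetic side, `ν_η³` is a Jacobi symbol times a power of `exp (π i / 4)`, and
under `M ↦ M * S` it changes by `exp (-3 π i / 4)` and that same sign
(`etaSign_mul_zetaEight_mul_S`). If `c` and `d` are both odd, this is quadratic reciprocity for
`c` and `d`; if one of them is even, the same Jacobi symbol stands on both sides, up to the
character `χ₄` and signs.

Right multiplication by `T` is immediate if `c` is odd, since the symbol `(d / |c|)` depends only on
`d` modulo `c`. If `c` is even, the relation `T = S T⁻¹ S T⁻¹ S` leads from `M` to `M * T` using `T⁻¹`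
at matrices with odd lower left entry only (`ThetaTransforms.mul_T`), so that no reciprocity
law for even entries is needed.
-/

/-! ### The cube of the eta multiplier -/

/-- The Jacobi symbol entering `nuEta`, as a function of the lower row of the matrix. -/
def etaSign (c d : ℤ) : ℤ := if Odd c then upperSymbol d c else lowerSymbol c d

/-- The integer entering the exponential in `nuEta`, as a function of the matrix entries. -/
def etaExponent (a b c d : ℤ) : ℤ :=
  if Odd c then (a + d) * c - b * d * (c ^ 2 - 1) - 3 * c
  else (a + d) * c - b * d * (c ^ 2 - 1) + 3 * d - 3 - 3 * c * d

/-- The powers `exp (π i n / 4)` of the standard primitive eighth root of unity. -/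
noncomputable def zetaEight (n : ℤ) : ℂ := Complex.exp (Real.pi * Complex.I / 4 * n)

lemma zetaEight_add (m n : ℤ) : zetaEight (m + n) = zetaEight m * zetaEight n := by
  rw [zetaEight, zetaEight, zetaEight, ← Complex.exp_add]
  congr 1
  push_cast
  ring

lemma zetaEight_eight_mul (n : ℤ) : zetaEight (8 * n) = 1 := by
  rw [zetaEight, Complex.exp_eq_one_iff]
  exact ⟨n, by push_cast; ring⟩

lemma zetaEight_four : zetaEight 4 = -1 := by
  rw [zetaEight, ← Complex.exp_pi_mul_I]
  congr 1
  push_cast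
  ring

lemma zetaEight_eq_of_sub_emod_eq_zero {m n : ℤ} (h : (m - n) % 8 = 0) :
    zetaEight m = zetaEight n := by
  obtain ⟨k, hk⟩ := Int.dvd_of_emod_eq_zero h
  rw [show m = n + 8 * k by omega, zetaEight_add, zetaEight_eight_mul, mul_one]

lemma zetaEight_eq_neg_of_sub_emod_eq_four {m n : ℤ} (h : (m - n) % 8 = 4) :
    zetaEight m = -zetaEight n := by
  rw [zetaEight_eq_of_sub_emod_eq_zero (n := n + 4) (by omega), zetaEight_add, zetaEight_four]
  ring

lemma etaSign_pow_three (c d : ℤ) : etaSign c d ^ 3 = etaSign c d := by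
  have key : ∀ (x : ℤ) (n : ℕ), jacobiSym x n ^ 3 = jacobiSym x n := fun x n => by
    rcases jacobiSym.trichotomy x n with h | h | h <;> rw [h] <;> norm_num
  unfold etaSign upperSymbol lowerSymbol
  split_ifs
  · exact key _ _
  · rcases lt_trichotomy d 0 with h | h | h
    · simp [Int.sign_eq_neg_one_of_neg h]
    · simp [h]
    · simp [Int.sign_eq_one_of_pos h]
  · rw [mul_pow, key]
    congr 1
    rw [← pow_mul, mul_comm, pow_mul]
    norm_num

lemma nuEta_pow_three (M : Matrix.SpecialLinearGroup (Fin 2) ℤ) :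
    nuEta M ^ 3 = (etaSign (M 1 0) (M 1 1) : ℂ) *
      zetaEight (etaExponent (M 0 0) (M 0 1) (M 1 0) (M 1 1)) := by
  rw [← etaSign_pow_three]
  unfold nuEta etaSign etaExponent zetaEight
  by_cases h : Odd (M 1 0)
  · simp only [h, if_true]
    rw [mul_pow, ← Complex.exp_nat_mul]
    push_cast
    congr 2
    ring
  · simp only [h, if_false]
    rw [mul_pow, ← Complex.exp_nat_mul]
    push_cast
    congr 2
    ring

/-! ### The multiplier under right multiplication by the generators -/

/-- The sign relating `√((dτ - c) / τ) √τ` to `√(dτ - c)` for `τ` in the upper half plane. -/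
def branchSign (c d : ℤ) : ℤ := if 0 < c ∧ d ≤ 0 then -1 else 1

/-- Quadratic reciprocity for odd integers of arbitrary signs. -/
lemma jacobiSym_neg_natAbs_of_odd {c d : ℤ} (hc : Odd c) (hd : Odd d) :
    jacobiSym (-c) d.natAbs = jacobiSym d c.natAbs * branchSign c d *
      (if c % 4 = 1 ∧ d % 4 = 3 then -1 else 1) := by
  have hc2 := Int.odd_iff.1 hc
  have hd2 := Int.odd_iff.1 hd
  obtain ⟨m, hm⟩ : ∃ m, m = c.natAbs := ⟨_, rfl⟩
  obtain ⟨n, hn⟩ : ∃ n, n = d.natAbs := ⟨_, rfl⟩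
  have hmo : Odd m := Nat.odd_iff.2 (by omega)
  have hno : Odd n := Nat.odd_iff.2 (by omega)
  have hrec := jacobiSym.quadratic_reciprocity_if (Nat.odd_iff.1 hmo) (Nat.odd_iff.1 hno)
  have hchi : ∀ k : ℕ, Odd k → ZMod.χ₄ (k : ZMod 4) = if k % 4 = 1 then 1 else -1 := fun k hk => by
    rcases Nat.odd_mod_four_iff.1 (Nat.odd_iff.1 hk) with h | h
    · rw [ZMod.χ₄_nat_one_mod_four h, if_pos h]
    · rw [ZMod.χ₄_nat_three_mod_four h, if_neg (by omega)]
  have hmn := jacobiSym.neg (m : ℤ) hno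
  have hnm := jacobiSym.neg (n : ℤ) hmo
  rw [hchi _ hno] at hmn
  rw [hchi _ hmo] at hnm
  rw [← hm, ← hn]
  unfold branchSign
  have hm0 : 0 < m := hmo.pos
  have hn0 : 0 < n := hno.pos
  have hm4 := Nat.odd_mod_four_iff.1 (Nat.odd_iff.1 hmo)
  have hn4 := Nat.odd_mod_four_iff.1 (Nat.odd_iff.1 hno)
  rcases Int.natAbs_eq c with h | h <;> rcases Int.natAbs_eq d with h' | h' <;>
    rw [← hm] at h <;> rw [← hn] at h' <;> rw [h, h'] <;>
    simp only [neg_neg, hmn, hnm] <;> rw [← hrec] <;>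
    rcases hm4 with h1 | h1 <;> rcases hn4 with h2 | h2 <;>
    (split_ifs <;> first | ring1 | (exfalso; omega))

/-- For nonzero entries the sign in the lower symbol is `-1` exactly if both entries are negative. -/
lemma lowerSymbol_of_ne_zero {c d : ℤ} (hc : c ≠ 0) (hd : d ≠ 0) :
    lowerSymbol c d = jacobiSym c d.natAbs * (if c < 0 ∧ d < 0 then -1 else 1) := by
  rw [lowerSymbol, if_neg hc]
  rcases hc.lt_or_gt with h | h <;> rcases hd.lt_or_gt with h' | h' <;>
    simp [Int.sign_eq_one_of_pos, Int.sign_eq_neg_one_of_neg, h, h', not_lt_of_gt]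

/-- How the sign and the exponent of `nuEta ^ 3` change under right multiplication by `S`, up to
simultaneously negating the sign and shifting the exponent by `4`. -/
lemma etaSign_etaExponent_mul_S {a b c d : ℤ} (h : a * d - b * c = 1) :
    (etaSign d (-c) = etaSign c d * branchSign c d ∧
      (etaExponent b (-a) d (-c) - (etaExponent a b c d - 3)) % 8 = 0) ∨
    (etaSign d (-c) = -(etaSign c d * branchSign c d) ∧
      (etaExponent b (-a) d (-c) - (etaExponent a b c d - 3)) % 8 = 4) := by
  unfold etaSign etaExponent upperSymbol
  by_cases hc : Odd c
  -- In each parity case the difference of the exponents simplifies by `h` to an explicit integer.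
  · by_cases hd : Odd d
    · simp only [hc, hd, if_true]
      rw [jacobiSym_neg_natAbs_of_odd hc hd]
      have e : (b + -c) * d - -a * -c * (d ^ 2 - 1) - 3 * d -
          ((a + d) * c - b * d * (c ^ 2 - 1) - 3 * c - 3) = -3 * ((c + 1) * (d - 1)) := by
        linear_combination (-c * d) * h
      rw [e]
      obtain ⟨k, hk⟩ := hc
      obtain ⟨l, hl⟩ := hd
      have e' : -3 * ((c + 1) * (d - 1)) = -12 * ((k + 1) * l) := by rw [hk, hl]; ring
      rw [e']
      split_ifs with h4
      · right
        refine ⟨by ring, ?_⟩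
        have : Odd ((k + 1) * l) := by
          rw [Int.odd_mul]
          constructor <;> rw [Int.odd_iff] <;> omega
        obtain ⟨t, ht⟩ := this
        omega
      · left
        refine ⟨by ring, ?_⟩
        have : Even ((k + 1) * l) := by
          rw [Int.even_mul, Int.even_iff, Int.even_iff]
          omega
        obtain ⟨t, ht⟩ := this
        omega
    · left
      simp only [hc, hd, if_true, if_false]
      have hd2 := Int.not_odd_iff.1 hd
      have hc2 := Int.odd_iff.1 hc
      constructor
      · unfold branchSign
        -- If `d = 0` then `c = ±1`, and the symbol `(0 / ±1)_*` has its own clause.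
        by_cases hd0 : d = 0
        · have hcu : IsUnit c := IsUnit.of_mul_eq_one (-b) (by rw [hd0] at h; linarith)
          rcases Int.isUnit_iff.1 hcu with rfl | rfl <;> simp [lowerSymbol, hd0]
        · rw [lowerSymbol_of_ne_zero hd0 (by omega), Int.natAbs_neg]
          congr 1
          split_ifs <;> first | rfl | (exfalso; omega)
      · have e : (b + -c) * d - -a * -c * (d ^ 2 - 1) + 3 * -c - 3 - 3 * d * -c -
            ((a + d) * c - b * d * (c ^ 2 - 1) - 3 * c - 3) = 0 := by
          linear_combination (-c * d) * h
        rw [e]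
        rfl
  · have hd : Odd d := by
      by_contra hd
      rw [Int.not_odd_iff_even] at hc hd
      have := (hd.mul_left a).sub (hc.mul_left b)
      rw [h] at this
      exact absurd this (by decide)
    simp only [hc, hd, if_true, if_false]
    have e : (b + -c) * d - -a * -c * (d ^ 2 - 1) - 3 * d -
        ((a + d) * c - b * d * (c ^ 2 - 1) + 3 * d - 3 - 3 * c * d - 3) = 6 - 6 * d := by
      linear_combination (-c * d) * h
    rw [e]
    have hd2 := Int.odd_iff.1 hd
    -- The symbol `(0 / ±1)_*` is given by a separate clause of its definition.
    by_cases hc0 : c = 0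
    · have hdu : IsUnit d := IsUnit.of_mul_eq_one a (by rw [hc0] at h; linarith)
      rcases Int.isUnit_iff.1 hdu with rfl | rfl <;>
        simp [lowerSymbol, branchSign, hc0]
    · rw [lowerSymbol_of_ne_zero hc0 (by omega), jacobiSym.neg _ (Int.natAbs_odd.2 hd)]
      unfold branchSign
      rcases Nat.odd_mod_four_iff.1 (Nat.odd_iff.1 (Int.natAbs_odd.2 hd)) with h4 | h4
      · rw [ZMod.χ₄_nat_one_mod_four h4]
        split_ifs <;> first
          | (left; exact ⟨by ring1, by omega⟩)
          | (right; exact ⟨by ring1, by omega⟩)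
      · rw [ZMod.χ₄_nat_three_mod_four h4]
        split_ifs <;> first
          | (left; exact ⟨by ring1, by omega⟩)
          | (right; exact ⟨by ring1, by omega⟩)

lemma etaSign_mul_zetaEight_mul_S {a b c d : ℤ} (h : a * d - b * c = 1) :
    (etaSign d (-c) : ℂ) * zetaEight (etaExponent b (-a) d (-c)) =
      etaSign c d * branchSign c d * zetaEight (etaExponent a b c d) * zetaEight (-3) := by
  rw [mul_assoc _ (zetaEight _), ← zetaEight_add, ← sub_eq_add_neg]
  rcases etaSign_etaExponent_mul_S h with ⟨h1, h2⟩ | ⟨h1, h2⟩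
  · rw [h1, zetaEight_eq_of_sub_emod_eq_zero h2]
    push_cast
    ring
  · rw [h1, zetaEight_eq_neg_of_sub_emod_eq_four h2]
    push_cast
    ring

lemma etaSign_mul_zetaEight_mul_T {a b c d : ℤ} (hc : Odd c) :
    (etaSign c (c + d) : ℂ) * zetaEight (etaExponent a (a + b) c (c + d)) =
      etaSign c d * zetaEight (etaExponent a b c d) * zetaEight 1 := by
  have hsign : etaSign c (c + d) = etaSign c d := by
    simp only [etaSign, hc, if_true, upperSymbol]
    refine jacobiSym.mod_left' (Int.ModEq.symm ((Int.modEq_iff_dvd).2 ?_))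
    simp
  rw [hsign, mul_assoc, ← zetaEight_add]
  congr 1
  apply zetaEight_eq_of_sub_emod_eq_zero
  simp only [etaExponent, hc, if_true]
  apply Int.emod_eq_zero_of_dvd
  have e : (a + (c + d)) * c - (a + b) * (c + d) * (c ^ 2 - 1) - 3 * c -
      ((a + d) * c - b * d * (c ^ 2 - 1) - 3 * c + 1) =
      (c ^ 2 - 1) * (1 - (a + b) * (c + d) + b * d) := by ring
  rw [e]
  exact Dvd.dvd.mul_right (Int.eight_dvd_sq_sub_one_of_odd hc) _

/-! ### The branch of the square root -/

lemma knoppSqrt_eq_exp {z : ℂ} (hz : z ≠ 0) :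
    knoppSqrt z = Complex.exp ((Real.log ‖z‖ + Complex.I * knoppArg z) / 2) := by
  have hpos : 0 < ‖z‖ := norm_pos_iff.2 hz
  rw [knoppSqrt, add_div, Complex.exp_add, Real.sqrt_eq_rpow, Real.rpow_def_of_pos hpos,
    Complex.ofReal_exp]
  congr 2
  push_cast
  ring

lemma knoppArg_coe_angle (z : ℂ) : (knoppArg z : Real.Angle) = Complex.arg z := by
  unfold knoppArg
  split_ifs with h
  · rw [h, Real.Angle.coe_neg, Real.Angle.neg_coe_pi]
  · rfl

lemma knoppArg_of_im_pos {z : ℂ} (hz : 0 < z.im) :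
    0 < knoppArg z ∧ knoppArg z < Real.pi := by
  have h1 : Complex.arg z < Real.pi := Complex.arg_lt_pi_iff.2 (Or.inr hz.ne')
  have h2 : 0 < Complex.arg z := by
    refine lt_of_le_of_ne (Complex.arg_nonneg_iff.2 hz.le) fun h => ?_
    exact hz.ne' (Complex.arg_eq_zero_iff.1 h.symm).2
  rw [knoppArg, if_neg h1.ne]
  exact ⟨h2, h1⟩

lemma knoppArg_of_im_neg {z : ℂ} (hz : z.im < 0) :
    -Real.pi < knoppArg z ∧ knoppArg z < 0 := by
  have h2 := Complex.arg_neg_iff.2 hz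
  rw [knoppArg, if_neg (by linarith [Real.pi_pos])]
  exact ⟨Complex.neg_pi_lt_arg z, h2⟩

lemma knoppArg_one : knoppArg 1 = 0 := by
  simp [knoppArg, Real.pi_ne_zero.symm]

lemma knoppArg_neg_one : knoppArg (-1) = -Real.pi := by
  simp [knoppArg]

lemma exists_knoppArg_add {z w : ℂ} (hz : z ≠ 0) (hw : w ≠ 0) :
    ∃ k : ℤ, knoppArg z + knoppArg w - knoppArg (z * w) = 2 * Real.pi * k := by
  rw [← Real.Angle.angle_eq_iff_two_pi_dvd_sub, Real.Angle.coe_add]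
  simp only [knoppArg_coe_angle]
  exact (Complex.arg_mul_coe_angle hz hw).symm

/-- `knoppSqrt` is multiplicative up to the sign `(-1) ^ k = zetaEight (4 * k)`, where `2πk` is the
defect of additivity of the arguments. -/
lemma knoppSqrt_mul_knoppSqrt {z w : ℂ} (hz : z ≠ 0) (hw : w ≠ 0) {k : ℤ}
    (hk : knoppArg z + knoppArg w - knoppArg (z * w) = 2 * Real.pi * k) :
    knoppSqrt z * knoppSqrt w = zetaEight (4 * k) * knoppSqrt (z * w) := by
  rw [knoppSqrt_eq_exp hz, knoppSqrt_eq_exp hw, knoppSqrt_eq_exp (mul_ne_zero hz hw), zetaEight,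
    ← Complex.exp_add, ← Complex.exp_add, norm_mul,
    Real.log_mul (norm_ne_zero_iff.2 hz) (norm_ne_zero_iff.2 hw)]
  have hk' : (knoppArg z : ℂ) + knoppArg w - knoppArg (z * w) = 2 * Real.pi * k := by
    exact_mod_cast hk
  congr 1
  push_cast
  linear_combination Complex.I / 2 * hk'

/-- For an integer matrix with coprime lower row `(c, d)` acting on `-1 / τ`, the automorphy factor
is `(dτ - c) / τ`; the sign of its square root is read off from the half planes containing
`(dτ - c) / τ` and `dτ - c`. -/
lemma knoppSqrt_automorphy_S {a b c d : ℤ} (h : a * d - b * c = 1) {τ : ℂ} (hτ : 0 < τ.im) :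
    knoppSqrt (c * (-1 / τ) + d) * knoppSqrt τ = branchSign c d * knoppSqrt (d * τ - c) := by
  have hτ0 : τ ≠ 0 := by rintro rfl; simp at hτ
  have hS : 0 < (-1 / τ).im := by
    rw [neg_div, Complex.neg_im, one_div, Complex.inv_im, neg_div, neg_neg]
    exact div_pos hτ (Complex.normSq_pos.2 hτ0)
  have hmul : (c * (-1 / τ) + d) * τ = d * τ - c := by field_simp; ring
  have him1 : (c * (-1 / τ) + d : ℂ).im = c * (-1 / τ).im := by simp
  have him2 : (d * τ - c : ℂ).im = d * τ.im := by simp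
  have hu : (c * (-1 / τ) + d : ℂ) ≠ 0 := by
    intro h0
    have h1 := congrArg Complex.im h0
    rw [him1] at h1
    have hc : c = 0 := by simpa [hS.ne'] using h1
    have hd : d = 0 := by simpa [hc] using h0
    simp [hc, hd] at h
  obtain ⟨k, hk⟩ := exists_knoppArg_add hu hτ0
  rw [knoppSqrt_mul_knoppSqrt hu hτ0 hk, hmul]
  rw [hmul] at hk
  obtain ⟨t1, t2⟩ := knoppArg_of_im_pos hτ
  have hpi := Real.pi_pos
  have hk_zero : -(2 * Real.pi) < 2 * Real.pi * k → 2 * Real.pi * k < 2 * Real.pi → k = 0 := by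
    intro h1 h2
    have h1' : (-1 : ℝ) < k := by nlinarith
    have h2' : (k : ℝ) < 1 := by nlinarith
    have h1'' : -1 < k := by exact_mod_cast h1'
    have h2'' : k < 1 := by exact_mod_cast h2'
    omega
  have hk_one : 0 < 2 * Real.pi * k → 2 * Real.pi * k < 4 * Real.pi → k = 1 := by
    intro h1 h2
    have h1' : (0 : ℝ) < k := by nlinarith
    have h2' : (k : ℝ) < 2 := by nlinarith
    have h1'' : 0 < k := by exact_mod_cast h1'
    have h2'' : k < 2 := by exact_mod_cast h2'
    omega
  have hpos : ∀ {n : ℤ} {x : ℝ}, 0 < n → 0 < x → 0 < (n : ℝ) * x :=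
    fun hn hx => mul_pos (by exact_mod_cast hn) hx
  have hneg : ∀ {n : ℤ} {x : ℝ}, n < 0 → 0 < x → (n : ℝ) * x < 0 :=
    fun hn hx => mul_neg_of_neg_of_pos (by exact_mod_cast hn) hx
  congr 1
  -- Both sides of `hk` are confined by half planes, which leaves `k = 0` or `k = 1`.
  suffices k = if 0 < c ∧ d ≤ 0 then 1 else 0 by
    rw [this, branchSign]
    split_ifs
    · simp [zetaEight_four]
    · simpa using zetaEight_eight_mul 0
  rcases lt_trichotomy c 0 with hc | hc | hc
  · obtain ⟨u1, u2⟩ := knoppArg_of_im_neg (him1 ▸ hneg hc hS)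
    rw [if_neg (by omega)]
    rcases lt_trichotomy d 0 with hd | hd | hd
    · obtain ⟨w1, w2⟩ := knoppArg_of_im_neg (him2 ▸ hneg hd hτ)
      exact hk_zero (by linarith) (by linarith)
    · have hc1 : c = -1 := by
        have := Int.isUnit_iff.1 (IsUnit.of_mul_eq_one (-b) (by rw [hd] at h; linarith) : IsUnit c)
        omega
      rw [show (d * τ - c : ℂ) = 1 by simp [hc1, hd], knoppArg_one] at hk
      exact hk_zero (by linarith) (by linarith)
    · obtain ⟨w1, w2⟩ := knoppArg_of_im_pos (him2 ▸ hpos hd hτ)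
      exact hk_zero (by linarith) (by linarith)
  · rw [if_neg (by omega)]
    have hd := Int.isUnit_iff.1
      (IsUnit.of_mul_eq_one a (by rw [hc] at h; linarith) : IsUnit d)
    rcases hd with hd | hd
    · obtain ⟨w1, w2⟩ := knoppArg_of_im_pos (him2 ▸ hpos (by omega : 0 < d) hτ)
      rw [show (c * (-1 / τ) + d : ℂ) = 1 by simp [hc, hd], knoppArg_one] at hk
      exact hk_zero (by linarith) (by linarith)
    · obtain ⟨w1, w2⟩ := knoppArg_of_im_neg (him2 ▸ hneg (by omega : d < 0) hτ)
      rw [show (c * (-1 / τ) + d : ℂ) = -1 by simp [hc, hd], knoppArg_neg_one] at hk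
      exact hk_zero (by linarith) (by linarith)
  · obtain ⟨u1, u2⟩ := knoppArg_of_im_pos (him1 ▸ hpos hc hS)
    rcases lt_trichotomy d 0 with hd | hd | hd
    · rw [if_pos (by omega)]
      obtain ⟨w1, w2⟩ := knoppArg_of_im_neg (him2 ▸ hneg hd hτ)
      exact hk_one (by linarith) (by linarith)
    · rw [if_pos (by omega)]
      have hc1 : c = 1 := by
        have := Int.isUnit_iff.1 (IsUnit.of_mul_eq_one (-b) (by rw [hd] at h; linarith) : IsUnit c)
        omega
      rw [show (d * τ - c : ℂ) = -1 by simp [hc1, hd], knoppArg_neg_one] at hk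
      exact hk_one (by linarith) (by linarith)
    · rw [if_neg (by omega)]
      obtain ⟨w1, w2⟩ := knoppArg_of_im_pos (him2 ▸ hpos hd hτ)
      exact hk_zero (by linarith) (by linarith)

/-! ### The theta function under the generators -/

lemma neg_I_mul_cpow_half {τ : ℂ} (hτ : 0 < τ.im) :
    (-Complex.I * τ) ^ (1 / 2 : ℂ) = zetaEight (-1) * knoppSqrt τ := by
  have hτ0 : τ ≠ 0 := by rintro rfl; simp at hτ
  have hI : (-Complex.I) ≠ 0 := neg_ne_zero.2 Complex.I_ne_zero
  obtain ⟨t1, t2⟩ := knoppArg_of_im_pos hτ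
  have harg : knoppArg τ = Complex.arg τ := by
    rw [knoppArg, if_neg (Complex.arg_lt_pi_iff.2 (Or.inr hτ.ne')).ne]
  have hmul : Complex.arg (-Complex.I * τ) = -(Real.pi / 2) + Complex.arg τ := by
    rw [(Complex.arg_mul_eq_add_arg_iff hI hτ0).2 (by
      rw [Complex.arg_neg_I, ← harg]; constructor <;> linarith), Complex.arg_neg_I]
  rw [Complex.cpow_def_of_ne_zero (mul_ne_zero hI hτ0), knoppSqrt_eq_exp hτ0, zetaEight,
    ← Complex.exp_add, Complex.log, hmul, harg]
  congr 1
  simp only [norm_mul, norm_neg, Complex.norm_I, one_mul]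
  push_cast
  ring

lemma thetaChar_one_one_eq_jacobiTheta₂ (v τ : ℂ) :
    thetaChar 1 1 v τ =
      Complex.exp (Real.pi * Complex.I * (τ / 4 + v + 1 / 2)) *
        jacobiTheta₂ (v + 1 / 2 + τ / 2) τ := by
  rw [thetaChar, jacobiTheta₂, ← tsum_mul_left]
  refine tsum_congr fun n => ?_
  rw [thetaCharTerm, jacobiTheta₂_term, ← Complex.exp_add]
  congr 1
  push_cast
  ring

lemma thetaChar_one_one_add_one (v τ : ℂ) :
    thetaChar 1 1 v (τ + 1) = zetaEight 1 * thetaChar 1 1 v τ := by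
  rw [thetaChar, thetaChar, ← tsum_mul_left]
  refine tsum_congr fun n => ?_
  rw [thetaCharTerm, thetaCharTerm, zetaEight, ← Complex.exp_add, Complex.exp_eq_exp_iff_exists_int]
  obtain ⟨m, hm⟩ := Int.even_mul_succ_self n
  have hm' : (n : ℂ) * (n + 1) = m + m := by exact_mod_cast hm
  -- `(n + 1/2)² / 2 = n (n + 1) / 2 + 1/8`, and `n (n + 1) / 2` is the integer `m`.
  refine ⟨m, ?_⟩
  push_cast
  linear_combination Real.pi * Complex.I * hm'

lemma thetaChar_one_one_S (v : ℂ) {τ : ℂ} (hτ : 0 < τ.im) :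
    thetaChar 1 1 (v / τ) (-1 / τ) = zetaEight (-3) * knoppSqrt τ *
      Complex.exp (Real.pi * Complex.I * (v ^ 2 / τ)) * thetaChar 1 1 v τ := by
  have hτ0 : τ ≠ 0 := by rintro rfl; simp at hτ
  have hne : zetaEight (-1) * knoppSqrt τ ≠ 0 := by
    rw [zetaEight, knoppSqrt_eq_exp hτ0]
    exact mul_ne_zero (Complex.exp_ne_zero _) (Complex.exp_ne_zero _)
  have hfe := jacobiTheta₂_functional_equation (v - 1 / 2 + τ / 2) τ
  rw [neg_I_mul_cpow_half hτ] at hfe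
  have hz : (v - 1 / 2 + τ / 2) / τ = v / τ + 1 / 2 + -1 / τ / 2 := by
    field_simp
    ring
  -- The point `v + (1 + τ) / 2` is first moved by the period `1`, so that division by `τ` turns it
  -- into the corresponding point for `(v / τ, -1 / τ)`.
  have hshift : jacobiTheta₂ (v + 1 / 2 + τ / 2) τ = jacobiTheta₂ (v - 1 / 2 + τ / 2) τ := by
    rw [← jacobiTheta₂_add_left (v - 1 / 2 + τ / 2)]
    congr 1
    ring
  have h31 : zetaEight (-3) = zetaEight (-1) * Complex.exp (-(Real.pi * Complex.I / 2)) := by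
    rw [show (-3 : ℤ) = -1 + -2 by norm_num, zetaEight_add]
    congr 1
    rw [zetaEight]
    congr 1
    push_cast
    ring
  rw [thetaChar_one_one_eq_jacobiTheta₂, thetaChar_one_one_eq_jacobiTheta₂, hshift, hfe, ← hz, h31]
  have hexp : Complex.exp (Real.pi * Complex.I * (-1 / τ / 4 + v / τ + 1 / 2)) =
      Complex.exp (-(Real.pi * Complex.I / 2)) *
      Complex.exp (Real.pi * Complex.I * (v ^ 2 / τ)) *
      Complex.exp (Real.pi * Complex.I * (τ / 4 + v + 1 / 2)) *
      Complex.exp (-Real.pi * Complex.I * (v - 1 / 2 + τ / 2) ^ 2 / τ) := by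
    rw [← Complex.exp_add, ← Complex.exp_add, ← Complex.exp_add,
      Complex.exp_eq_exp_iff_exists_int]
    refine ⟨0, ?_⟩
    field_simp
    push_cast
    ring
  rw [hexp]
  generalize jacobiTheta₂ ((v - 1 / 2 + τ / 2) / τ) (-1 / τ) = J
  linear_combination (-(Complex.exp (-(Real.pi * Complex.I / 2)) *
    Complex.exp (Real.pi * Complex.I * (v ^ 2 / τ)) *
    Complex.exp (Real.pi * Complex.I * (τ / 4 + v + 1 / 2)) *
    Complex.exp (-Real.pi * Complex.I * (v - 1 / 2 + τ / 2) ^ 2 / τ) * J)) *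
      mul_div_cancel₀ 1 hne

/-! ### Induction along the generators of the modular group -/

/-- The transformation formula of `θ[1, 1]` holds for `M`, for all arguments. -/
def ThetaTransforms (M : Matrix.SpecialLinearGroup (Fin 2) ℤ) : Prop :=
  ∀ v τ : ℂ, 0 < τ.im →
    thetaChar 1 1 (v / (M 1 0 * τ + M 1 1)) ((M 0 0 * τ + M 0 1) / (M 1 0 * τ + M 1 1)) =
      nuEta M ^ 3 * knoppSqrt (M 1 0 * τ + M 1 1) *
        Complex.exp (Real.pi * Complex.I * (M 1 0 * v ^ 2 / (M 1 0 * τ + M 1 1))) *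
          thetaChar 1 1 v τ

open ModularGroup in
lemma coe_mul_S_apply (M : Matrix.SpecialLinearGroup (Fin 2) ℤ) :
    (M * S) 0 0 = M 0 1 ∧ (M * S) 0 1 = -M 0 0 ∧ (M * S) 1 0 = M 1 1 ∧
      (M * S) 1 1 = -M 1 0 := by
  simp [Matrix.mul_apply, Fin.sum_univ_two, ModularGroup.coe_S]

open ModularGroup in
lemma coe_mul_T_apply (M : Matrix.SpecialLinearGroup (Fin 2) ℤ) :
    (M * T) 0 0 = M 0 0 ∧ (M * T) 0 1 = M 0 0 + M 0 1 ∧ (M * T) 1 0 = M 1 0 ∧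
      (M * T) 1 1 = M 1 0 + M 1 1 := by
  simp [Matrix.mul_apply, Fin.sum_univ_two, ModularGroup.coe_T]

open ModularGroup in
lemma ThetaTransforms.mul_S {M : Matrix.SpecialLinearGroup (Fin 2) ℤ} (hM : ThetaTransforms M) :
    ThetaTransforms (M * S) := by
  intro v τ hτ
  have hτ0 : τ ≠ 0 := by rintro rfl; simp at hτ
  have hS : 0 < (-1 / τ).im := by
    rw [neg_div, Complex.neg_im, one_div, Complex.inv_im, neg_div, neg_neg]
    exact div_pos hτ (Complex.normSq_pos.2 hτ0)
  have hdet : M 0 0 * M 1 1 - M 0 1 * M 1 0 = 1 := by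
    rw [← Matrix.det_fin_two, M.det_coe]
  have key := hM (v / τ) (-1 / τ) hS
  obtain ⟨e00, e01, e10, e11⟩ := coe_mul_S_apply M
  rw [nuEta_pow_three] at key ⊢
  rw [e00, e01, e10, e11, etaSign_mul_zetaEight_mul_S hdet]
  have hsq := knoppSqrt_automorphy_S hdet hτ
  rw [thetaChar_one_one_S v hτ] at key
  generalize M 0 0 = a at *
  generalize M 0 1 = b at *
  generalize M 1 0 = c at *
  generalize M 1 1 = d at *
  have hw : (d * τ - c : ℂ) ≠ 0 := by
    intro h0
    have h1 := congrArg Complex.im h0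
    have hd : d = 0 := by simpa [hτ.ne'] using h1
    have hc : c = 0 := by simpa [hd] using h0
    simp [hc, hd] at hdet
  have hu : (c * (-1 / τ) + d : ℂ) = (d * τ - c) / τ := by field_simp; ring
  rw [hu] at hsq key
  have a1 : v / τ / ((d * τ - c) / τ) = v / (d * τ + (-c : ℤ)) := by
    push_cast; rw [← sub_eq_add_neg]; field_simp
  have a2 : (a * (-1 / τ) + b : ℂ) / ((d * τ - c) / τ) =
      (b * τ + (-a : ℤ)) / (d * τ + (-c : ℤ)) := by
    push_cast; rw [← sub_eq_add_neg (_ * _) (c : ℂ)]; field_simp; ring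
  have a3 : Complex.exp (Real.pi * Complex.I * (d * v ^ 2 / (d * τ + (-c : ℤ)))) =
      Complex.exp (Real.pi * Complex.I * (c * (v / τ) ^ 2 / ((d * τ - c) / τ))) *
        Complex.exp (Real.pi * Complex.I * (v ^ 2 / τ)) := by
    rw [← Complex.exp_add]
    congr 1
    push_cast; rw [← sub_eq_add_neg (_ * _) (c : ℂ)]; field_simp; ring
  have a4 : (d * τ + (-c : ℤ) : ℂ) = d * τ - c := by push_cast; ring
  rw [← a1, ← a2, key, a3, a4]
  linear_combination (etaSign c d * zetaEight (etaExponent a b c d) * zetaEight (-3) *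
    Complex.exp (Real.pi * Complex.I * (c * (v / τ) ^ 2 / ((d * τ - c) / τ))) *
    Complex.exp (Real.pi * Complex.I * (v ^ 2 / τ)) * thetaChar 1 1 v τ) * hsq

open ModularGroup in
/-- For `c` odd the multiplier of `M * T` is `exp (π i / 4)` times that of `M`, so the
transformation formulas for `M` and `M * T` are equivalent. -/
lemma thetaTransforms_mul_T_iff {M : Matrix.SpecialLinearGroup (Fin 2) ℤ} (hc : Odd (M 1 0)) :
    ThetaTransforms (M * T) ↔ ThetaTransforms M := by
  have step : ∀ v τ : ℂ,
      (thetaChar 1 1 (v / ((M * T) 1 0 * τ + (M * T) 1 1))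
          (((M * T) 0 0 * τ + (M * T) 0 1) / ((M * T) 1 0 * τ + (M * T) 1 1)) =
        nuEta (M * T) ^ 3 * knoppSqrt ((M * T) 1 0 * τ + (M * T) 1 1) *
          Complex.exp (Real.pi * Complex.I *
            ((M * T) 1 0 * v ^ 2 / ((M * T) 1 0 * τ + (M * T) 1 1))) * thetaChar 1 1 v τ) ↔
      (thetaChar 1 1 (v / (M 1 0 * (τ + 1) + M 1 1))
          ((M 0 0 * (τ + 1) + M 0 1) / (M 1 0 * (τ + 1) + M 1 1)) =
        nuEta M ^ 3 * knoppSqrt (M 1 0 * (τ + 1) + M 1 1) *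
          Complex.exp (Real.pi * Complex.I * (M 1 0 * v ^ 2 / (M 1 0 * (τ + 1) + M 1 1))) *
            thetaChar 1 1 v (τ + 1)) := by
    intro v τ
    obtain ⟨e00, e01, e10, e11⟩ := coe_mul_T_apply M
    rw [nuEta_pow_three, nuEta_pow_three, e00, e01, e10, e11, etaSign_mul_zetaEight_mul_T hc,
      thetaChar_one_one_add_one]
    have h1 : (M 1 0 * τ + (M 1 0 + M 1 1 : ℤ) : ℂ) = M 1 0 * (τ + 1) + M 1 1 := by
      push_cast; ring
    have h2 : (M 0 0 * τ + (M 0 0 + M 0 1 : ℤ) : ℂ) = M 0 0 * (τ + 1) + M 0 1 := by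
      push_cast; ring
    rw [h1, h2]
    constructor <;> intro h <;> rw [h] <;> ring
  constructor
  · intro h v τ hτ
    have := (step v (τ - 1)).1 (h v (τ - 1) (by simpa using hτ))
    simpa using this
  · intro h v τ hτ
    exact (step v τ).2 (h v (τ + 1) (by simpa using hτ))

lemma thetaTransforms_one : ThetaTransforms 1 := by
  intro v τ _
  rw [nuEta_pow_three]
  simp [etaSign, lowerSymbol, etaExponent, knoppSqrt, knoppArg_one, zetaEight]

open ModularGroup in
lemma ThetaTransforms.mul_S_inv {M : Matrix.SpecialLinearGroup (Fin 2) ℤ}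
    (hM : ThetaTransforms M) : ThetaTransforms (M * S⁻¹) := by
  have h : M * S⁻¹ = M * S * S * S := by
    rw [mul_inv_eq_iff_eq_mul]
    ext i j
    fin_cases i <;> fin_cases j <;>
      simp [Matrix.mul_apply, Fin.sum_univ_two, ModularGroup.coe_S]
  rw [h]
  exact hM.mul_S.mul_S.mul_S

open ModularGroup in
lemma ThetaTransforms.mul_T_inv_of_odd {M : Matrix.SpecialLinearGroup (Fin 2) ℤ}
    (hM : ThetaTransforms M) (hc : Odd (M 1 0)) : ThetaTransforms (M * T⁻¹) := by
  rw [← thetaTransforms_mul_T_iff, inv_mul_cancel_right]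
  · exact hM
  · have := (coe_mul_T_apply (M * T⁻¹)).2.2.1
    rw [inv_mul_cancel_right] at this
    rwa [← this]

open ModularGroup in
lemma odd_mul_S_one_zero {M : Matrix.SpecialLinearGroup (Fin 2) ℤ} (hc : Even (M 1 0)) :
    Odd ((M * S) 1 0) := by
  have hdet : M 0 0 * M 1 1 - M 0 1 * M 1 0 = 1 := by
    rw [← Matrix.det_fin_two, M.det_coe]
  rw [(coe_mul_S_apply M).2.2.1]
  by_contra hd
  rw [Int.not_odd_iff_even] at hd
  have := (hd.mul_left (M 0 0)).sub (hc.mul_left (M 0 1))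
  rw [hdet] at this
  exact absurd this (by decide)

open ModularGroup in
/-- For `c` even, `M * T` is reached from `M` through the relation `T = S T⁻¹ S T⁻¹ S`, along which
`T⁻¹` is only ever applied to matrices whose lower left entry is odd. -/
lemma ThetaTransforms.mul_T {M : Matrix.SpecialLinearGroup (Fin 2) ℤ} (hM : ThetaTransforms M) :
    ThetaTransforms (M * T) := by
  rcases Int.even_or_odd (M 1 0) with hc | hc
  · have hrel : M * T = M * S * T⁻¹ * S * T⁻¹ * S := by
      simp only [mul_assoc]
      congr 1
      ext i j
      fin_cases i <;> fin_cases j <;>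
        simp [Matrix.mul_apply, Fin.sum_univ_two, coe_S, coe_T]
    have h1 := odd_mul_S_one_zero hc
    have h2 : Odd ((M * S * T⁻¹ * S) 1 0) := by
      have e : (M * S * T⁻¹ * S) 1 0 = -(M * S) 1 0 - M 1 0 := by
        simp [Matrix.mul_apply, Fin.sum_univ_two, coe_S]
        ring
      rw [e]
      exact h1.neg.sub_even hc
    rw [hrel]
    exact ((hM.mul_S.mul_T_inv_of_odd h1).mul_S.mul_T_inv_of_odd h2).mul_S
  · exact (thetaTransforms_mul_T_iff hc).2 hM

open ModularGroup in
lemma ThetaTransforms.mul_T_inv {M : Matrix.SpecialLinearGroup (Fin 2) ℤ}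
    (hM : ThetaTransforms M) : ThetaTransforms (M * T⁻¹) := by
  have hrel : M * T⁻¹ = M * S * T * S * T * S⁻¹ := by
    simp only [mul_assoc]
    congr 1
    rw [← mul_assoc, ← mul_assoc, ← mul_assoc, eq_mul_inv_iff_mul_eq]
    ext i j
    fin_cases i <;> fin_cases j <;>
      simp [Matrix.mul_apply, Fin.sum_univ_two, coe_S, coe_T]
  rw [hrel]
  exact hM.mul_S.mul_T.mul_S.mul_T.mul_S_inv

theorem thetaTransforms_all (M : Matrix.SpecialLinearGroup (Fin 2) ℤ) : ThetaTransforms M := by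
  have hM : M ∈ Subgroup.closure {ModularGroup.S, ModularGroup.T} := by
    rw [SpecialLinearGroup.SL2Z_generators]
    trivial
  induction hM using Subgroup.closure_induction_right with
  | one => exact thetaTransforms_one
  | mul_right x hx y hy ih =>
    rcases hy with rfl | rfl
    · exact ih.mul_S
    · exact ih.mul_T
  | mul_inv_cancel x hx y hy ih =>
    rcases hy with rfl | rfl
    · exact ih.mul_S_inv
    · exact ih.mul_T_inv

/-- The transformation formula of `θ[1, 1]` under `M = (a b; c d) ∈ SL(2, ℤ)`. -/
theorem mainTheorem1 (M : Matrix.SpecialLinearGroup (Fin 2) ℤ) (a b c d : ℤ)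
    (ha : a = M 0 0) (hb : b = M 0 1) (hc : c = M 1 0) (hd : d = M 1 1)
    (v τ : ℂ) (hτ : 0 < τ.im) :
    thetaChar 1 1 (v / (c * τ + d)) ((a * τ + b) / (c * τ + d)) =
      nuEta M ^ 3 * knoppSqrt (c * τ + d) *
        Complex.exp (Real.pi * Complex.I * (c * v ^ 2 / (c * τ + d))) *
          thetaChar 1 1 v τ := by
  subst ha hb hc hd
  exact thetaTransforms_all M v τ hτ
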